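/- All graphs are finite and simple. A bipartite graph is always given together with a fixed bipartition of its vertex set into two (possibly empty) independent sets, its sides. For disjoint sets $A,B\subseteq V(G)$, the graph $G[A,B]$ semi-induced by $A$ and $B$ is the bipartite graph with sides $A$ and $B$ in which $u\in A$ and $v\in B$ are adjacent if and only if they are adjacent in $G$. A graph $G$ excludes a bipartite graph $H$ as a semi-induced subgraph if no $G[A,B]$ with $A,B\subseteq V(G)$ disjoint is isomorphic to $H$ by an isomorphism respecting the bipartitions. Let $P_t$ be the path on $t$ vertices, whose sides are the vertices at odd positions and the vertices at even positions along the path; let $\widetilde{P}_t$ be its bipartite complement, that is, the bipartite graph with the same vertices and sides in which two vertices from different sides are adjacent if and only if they are non-adjacent in $P_t$; and let $H_k$ be the half-graph of order $k$, the bipartite graph with sides $\{a_1,\dots,a_k\}$ and $\{b_1,\dots,b_k\}$ and edges $a_ib_j$ for all $1\le i\le j\le k$. Corollary (bounded discrepancy). For every pair of integers $t,k\in\mathbb{N}$ there exists a constant $C$ such that the vertices of every graph $G$ that excludes $P_t$, $\widetilde{P}_t$ and $H_k$ as semi-induced subgraphs can be colored with two colors (not necessarily properly) in such a way that for every vertex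 $u$ of $G$, the numbers of neighbors of $u$ in the two colors differ by at most $C$. -/

import Mathlib

/-- A bipartite graph given together with a fixed bipartition `left`, `right` of its vertex set
into two (possibly empty) independent sets. -/
structure BipartiteGraph (W : Type*) where
  graph : SimpleGraph W
  left : Set W
  right : Set W
  isBipartiteWith : graph.IsBipartiteWith left right
  cover : left ∪ right = Set.univ

namespace BipartiteGraph

/-- The bipartite complement: same vertices and sides, and two vertices from different sides are
adjacent iff they were not adjacent. -/
def bipartiteCompl {W : Type*} (H : BipartiteGraph W) : BipartiteGraph W where
  graph := (H.graph)ᶜ.between H.left H.right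
  left := H.left
  right := H.right
  isBipartiteWith := SimpleGraph.between_isBipartiteWith H.isBipartiteWith.disjoint
  cover := H.cover

/-- The path `P_t` on `t` vertices `0, …, t - 1`, whose sides are the even and the odd vertices. -/
def path (t : ℕ) : BipartiteGraph (Fin t) where
  graph := SimpleGraph.pathGraph t
  left := {i | Even (i : ℕ)}
  right := {i | ¬ Even (i : ℕ)}
  isBipartiteWith :=
    { disjoint := Set.disjoint_left.2 fun _ h h' => h' h
      mem_of_adj := by
        intro u v h
        rw [SimpleGraph.pathGraph_adj] at h
        simp only [Set.mem_ofPred_eq, Nat.even_iff]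
        omega }
  cover := by
    ext i
    simpa using Nat.even_or_odd (i : ℕ)

/-- The half-graph `H_k`: vertices `a_i = Sum.inl i` and `b_j = Sum.inr j` for `i, j < k`, with an
edge between `a_i` and `b_j` iff `i ≤ j`, and no other edges. -/
def halfGraph (k : ℕ) : BipartiteGraph (Fin k ⊕ Fin k) where
  graph := SimpleGraph.fromRel fun x y => ∃ i j : Fin k, x = Sum.inl i ∧ y = Sum.inr j ∧ i ≤ j
  left := Set.range Sum.inl
  right := Set.range Sum.inr
  isBipartiteWith :=
    { disjoint := Set.isCompl_range_inl_range_inr.disjoint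
      mem_of_adj := by
        intro u v h
        rw [SimpleGraph.fromRel_adj] at h
        rcases h with ⟨_, ⟨i, j, rfl, rfl, _⟩ | ⟨i, j, rfl, rfl, _⟩⟩
        · exact Or.inl ⟨⟨i, rfl⟩, ⟨j, rfl⟩⟩
        · exact Or.inr ⟨⟨j, rfl⟩, ⟨i, rfl⟩⟩ }
  cover := Set.range_inl_union_range_inr

end BipartiteGraph

/-- The graph `G[A, B]` semi-induced by `A` and `B`: its vertex set is `A ∪ B` and its edges are the
edges of `G` with one endpoint in `A` and the other one in `B`. -/
def SimpleGraph.semiInduced {V : Type*} (G : SimpleGraph V) (A B : Set V) :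
    SimpleGraph ↥(A ∪ B) :=
  (G.between A B).induce (A ∪ B)

/-- `G` contains the bipartite graph `H` as a semi-induced subgraph: for some disjoint sets `A`, `B`
of vertices, `G[A, B]` with bipartition `A`, `B` is isomorphic to `H` with its bipartition. -/
def SimpleGraph.ContainsSemiInduced {V W : Type*} (G : SimpleGraph V) (H : BipartiteGraph W) :
    Prop :=
  ∃ A B : Set V, Disjoint A B ∧ ∃ e : H.graph ≃g G.semiInduced A B,
    (∀ w, w ∈ H.left ↔ (e w : V) ∈ A) ∧ (∀ w, w ∈ H.right ↔ (e w : V) ∈ B)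

-- If the adjacency matrix is a product in which the vectors `f x`, `g y` indexing rows and columns
-- have `ℓ¹` norm at most `C`, then Beck–Fiala applied to the `f x` gives signs making every
-- coordinate of the signed sum of the `f x` at most `2C` in absolute value. Pairing with `g y`
-- bounds every signed column sum by `2C²`, which is the discrepancy bound. It remains to factor the
-- adjacency matrix with `C` depending only on `t` and `k`.
--
-- Excluding `H_k` bounds the depth of split trees, a rank as in stability theory, and the induction
-- is on this rank. A vertex whose neighbourhood and non-neighbourhood both had full rank would be
-- the root of a deeper tree, so for each vertex one of the two has smaller rank and factors by
-- induction. This cuts each side in two.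
--
-- If all neighbourhoods are of smaller rank, a Gyárfás path argument applies
-- (`BlockFactors.of_cutConnected`): peeling off neighbourhoods along a growing induced path stops
-- after `t` rounds. If all non-neighbourhoods are, the same holds in the complement. In a mixed
-- block, the absence of a ladder gives a cover of one side by at most `k` pieces of smaller rank
-- (`hasPattern_or_cover`).

universe u

/-! ### Rounding: the Beck–Fiala theorem -/

open Finset in
/-- One rounding step: a point of the cube can be moved along a direction supported on its
fractional coordinates until one more coordinate becomes `±1`. -/
theorem exists_step_to_cube_face {α : Type*} [Fintype α] (x y : α → ℝ)
    (hx : ∀ a, |x a| ≤ 1) (hy : ∀ a, |x a| = 1 → y a = 0) (hy0 : y ≠ 0) :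
    ∃ s : ℝ, (∀ a, |x a + s * y a| ≤ 1) ∧ ∃ a, |x a| ≠ 1 ∧ |x a + s * y a| = 1 := by
  classical
  have hne : (univ.filter fun a => y a ≠ 0).Nonempty := by
    obtain ⟨a, ha⟩ := Function.ne_iff.1 hy0
    exact ⟨a, by simpa using ha⟩
  -- The quotient is the time at which coordinate `a`, moving with velocity `y a`, reaches the wall
  -- it heads for; stop at the first such time.
  obtain ⟨a, ha, hmin⟩ := exists_min_image _
    (fun a => (1 - SignType.sign (y a) * x a) / |y a|) hne
  have ha0 : y a ≠ 0 := by simpa using ha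
  set s := (1 - SignType.sign (y a) * x a) / |y a| with hs
  have hsnonneg : 0 ≤ s := by
    apply div_nonneg _ (abs_nonneg _)
    have := abs_le.1 (hx a)
    rcases lt_trichotomy (y a) 0 with h | h | h <;> simp [h] <;> linarith
  have key : ∀ b, y b ≠ 0 → s * |y b| ≤ 1 - SignType.sign (y b) * x b := by
    intro b hb
    have := hmin b (by simpa using hb)
    rwa [le_div_iff₀ (abs_pos.2 hb)] at this
  refine ⟨s, fun b => ?_, a, fun h => ha0 (hy a h), ?_⟩
  · by_cases hb : y b = 0
    · simpa [hb] using hx b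
    · have h1 := key b hb
      have h2 := abs_le.1 (hx b)
      rw [abs_le]
      rcases lt_or_gt_of_ne hb with h | h
      · have h3 := mul_nonneg hsnonneg (neg_nonneg.2 h.le)
        simp [h, abs_of_neg h] at h1
        constructor <;> linarith
      · have h3 := mul_nonneg hsnonneg h.le
        simp [h, abs_of_pos h] at h1
        constructor <;> linarith
  · have h1 : s * |y a| = 1 - SignType.sign (y a) * x a := by
      rw [hs, div_mul_cancel₀ _ (abs_ne_zero.2 ha0)]
    rcases lt_or_gt_of_ne ha0 with h | h
    · simp [h, abs_of_neg h] at h1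
      rw [show x a + s * y a = -1 by linarith]; simp
    · simp [h, abs_of_pos h] at h1
      rw [show x a + s * y a = 1 by linarith]; simp

open Finset in
/-- The **Beck–Fiala theorem** for vectors of bounded `ℓ¹` norm. -/
theorem beckFiala {α ι : Type*} [Fintype α] [Fintype ι] (f : α → ι → ℝ) {C : ℝ} (hC : 0 ≤ C)
    (hf : ∀ a, ∑ i, |f a i| ≤ C) (x : α → ℝ) (hx : ∀ a, |x a| ≤ 1) :
    ∃ ε : α → ℝ, (∀ a, |ε a| = 1) ∧ (∀ a, |x a| = 1 → ε a = x a) ∧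
      ∀ i, |∑ a, (ε a - x a) * f a i| ≤ 2 * C := by
  classical
  induction hn : (univ.filter fun a => |x a| ≠ 1).card using Nat.strong_induction_on
    generalizing x with
  | _ n ih =>
  set F := univ.filter fun a => |x a| ≠ 1 with hF
  have memF : ∀ a, a ∈ F ↔ |x a| ≠ 1 := by simp [hF]
  rcases F.eq_empty_or_nonempty with hFe | ⟨a₀, ha₀⟩
  · have h1 : ∀ a, |x a| = 1 := fun a => by
      by_contra h
      have := (memF a).2 h
      simp [hFe] at this
    refine ⟨x, h1, fun _ _ => rfl, fun i => ?_⟩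
    simpa using hC
  -- Only constraints whose mass on the fractional coordinates exceeds `C` are kept exact. Double
  -- counting shows that there are fewer of them than fractional coordinates, so a nonzero direction
  -- preserves them all.
  set R := univ.filter fun i => C < ∑ a ∈ F, |f a i| with hR
  have hcard : R.card < F.card := by
    rcases R.eq_empty_or_nonempty with h | h
    · rw [h, card_empty]; exact card_pos.2 ⟨a₀, ha₀⟩
    have h1 : C * R.card < C * F.card := by
      calc C * R.card = ∑ i ∈ R, C := by simp [mul_comm]
        _ < ∑ i ∈ R, ∑ a ∈ F, |f a i| := sum_lt_sum_of_nonempty h fun i hi => by simpa [hR] using hi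
        _ = ∑ a ∈ F, ∑ i ∈ R, |f a i| := sum_comm
        _ ≤ ∑ a ∈ F, C := sum_le_sum fun a _ =>
            (sum_le_sum_of_subset_of_nonneg (subset_univ _) fun _ _ _ => abs_nonneg _).trans (hf a)
        _ = C * F.card := by simp [mul_comm]
    exact_mod_cast lt_of_mul_lt_mul_left h1 hC
  let φ : (F → ℝ) →ₗ[ℝ] (R → ℝ) := Matrix.mulVecLin (Matrix.of fun (i : R) (a : F) => f a i)
  obtain ⟨z, hz, hz0⟩ := (Submodule.ne_bot_iff _).1
    (LinearMap.ker_ne_bot_of_finrank_lt (f := φ) (by simpa using hcard))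
  let y : α → ℝ := fun a => if h : a ∈ F then z ⟨a, h⟩ else 0
  have hyR : ∀ i ∈ R, ∑ a, y a * f a i = 0 := by
    intro i hi
    have h1 := congrFun (LinearMap.mem_ker.1 hz) ⟨i, hi⟩
    simp only [φ, Matrix.mulVecLin_apply, Matrix.mulVec, dotProduct, Matrix.of_apply,
      Pi.zero_apply] at h1
    rw [← sum_subset (subset_univ F) (fun a _ ha => by simp [y, ha]), ← sum_attach, ← h1]
    exact sum_congr rfl fun a _ => by simp [y, mul_comm]
  obtain ⟨s, hs, a₁, ha₁, ha₁'⟩ := exists_step_to_cube_face x y hx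
    (fun a ha => by simp [y, memF, ha]) (fun h => hz0 (by
      ext a
      simpa [y] using congrFun h a))
  have hfix : ∀ a, |x a| = 1 → x a + s * y a = x a := fun a ha => by simp [y, memF, ha]
  obtain ⟨ε, h1, h2, h3⟩ := ih _ (by
    rw [← hn]
    apply card_lt_card
    refine (ssubset_iff_of_subset fun a => ?_).2 ⟨a₁, (memF _).2 ha₁, by simp [ha₁']⟩
    simp only [mem_filter, mem_univ, true_and, memF]
    exact fun h h' => h (by rw [hfix a h', h'])) (fun a => x a + s * y a) hs rfl
  have h2' : ∀ a, |x a| = 1 → ε a = x a := fun a ha => by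
    rw [h2 a (by rw [hfix a ha, ha]), hfix a ha]
  refine ⟨ε, h1, h2', fun i => ?_⟩
  -- A heavy constraint does not change in this step and inherits the inductive bound. A light one
  -- can be abandoned: each fractional coordinate moves by at most `2` in total from here on.
  by_cases hi : i ∈ R
  · have h4 : ∑ a, (ε a - x a) * f a i
        = ∑ a, (ε a - (x a + s * y a)) * f a i + s * ∑ a, y a * f a i := by
      rw [mul_sum, ← sum_add_distrib]
      exact sum_congr rfl fun a _ => by ring
    rw [h4, hyR i hi, mul_zero, add_zero]
    exact h3 i
  · calc |∑ a, (ε a - x a) * f a i| = |∑ a ∈ F, (ε a - x a) * f a i| := by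
          rw [sum_subset (subset_univ F)]
          intro a _ ha
          rw [h2' a (by simpa [memF] using ha), sub_self, zero_mul]
      _ ≤ ∑ a ∈ F, |(ε a - x a) * f a i| := abs_sum_le_sum_abs _ _
      _ ≤ ∑ a ∈ F, 2 * |f a i| := sum_le_sum fun a _ => by
          rw [abs_mul]
          gcongr
          have := abs_sub (ε a) (x a)
          linarith [h1 a, hx a]
      _ = 2 * ∑ a ∈ F, |f a i| := by rw [mul_sum]
      _ ≤ 2 * C := by
          have : ∑ a ∈ F, |f a i| ≤ C := by simpa [hR] using hi
          linarith

/-! ### Calculus of `ℓ¹` factorizations -/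

/-- An integer matrix factors through vectors whose `ℓ¹` norms are at most `C`. -/
def HasL1Factorization {V : Type u} (C : ℕ) (M : V → V → ℤ) : Prop :=
  ∃ (ι : Type u) (_ : Fintype ι) (f g : V → ι → ℤ), (∀ x, ∑ i, |f x i| ≤ C) ∧
    (∀ y, ∑ i, |g y i| ≤ C) ∧ ∀ x y, M x y = ∑ i, f x i * g y i

namespace HasL1Factorization

variable {V : Type u} {C D : ℕ} {M N : V → V → ℤ}

theorem mono (h : HasL1Factorization C M) (hCD : C ≤ D) : HasL1Factorization D M := by
  obtain ⟨ι, _, f, g, hf, hg, hM⟩ := h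
  have : (C : ℤ) ≤ D := by exact_mod_cast hCD
  exact ⟨ι, _, f, g, fun x => (hf x).trans this, fun x => (hg x).trans this, hM⟩

theorem congr (h : HasL1Factorization C M) (hMN : ∀ x y, N x y = M x y) :
    HasL1Factorization C N := by
  rwa [show N = M from funext₂ hMN]

theorem zero : HasL1Factorization C (fun _ _ : V => 0) :=
  ⟨PEmpty, inferInstance, fun _ _ => 0, fun _ _ => 0, by simp, by simp, by simp⟩

theorem transpose (h : HasL1Factorization C M) : HasL1Factorization C (fun x y => M y x) := by
  obtain ⟨ι, _, f, g, hf, hg, hM⟩ := h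
  exact ⟨ι, _, g, f, hg, hf, fun x y => by simp [hM, mul_comm]⟩

theorem neg (h : HasL1Factorization C M) : HasL1Factorization C (fun x y => -M x y) := by
  obtain ⟨ι, _, f, g, hf, hg, hM⟩ := h
  exact ⟨ι, _, fun x i => -f x i, g, by simpa using hf, hg, fun x y => by simp [hM]⟩

theorem add (hM : HasL1Factorization C M) (hN : HasL1Factorization D N) :
    HasL1Factorization (C + D) (fun x y => M x y + N x y) := by
  obtain ⟨ι, _, f, g, hf, hg, hM⟩ := hM
  obtain ⟨κ, _, f', g', hf', hg', hN⟩ := hN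
  refine ⟨ι ⊕ κ, inferInstance, fun x => Sum.elim (f x) (f' x), fun x => Sum.elim (g x) (g' x),
    fun x => ?_, fun x => ?_, fun x y => ?_⟩
  · simpa using add_le_add (hf x) (hf' x)
  · simpa using add_le_add (hg x) (hg' x)
  · simp [hM, hN]

theorem sub (hM : HasL1Factorization C M) (hN : HasL1Factorization D N) :
    HasL1Factorization (C + D) (fun x y => M x y - N x y) :=
  (hM.add hN.neg).congr fun _ _ => sub_eq_add_neg _ _

open Classical in
theorem mask (h : HasL1Factorization C M) (A B : Set V) :
    HasL1Factorization C (fun x y => if x ∈ A ∧ y ∈ B then M x y else 0) := by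
  obtain ⟨ι, _, f, g, hf, hg, hM⟩ := h
  refine ⟨ι, inferInstance, fun x i => if x ∈ A then f x i else 0, fun y i => if y ∈ B then g y i else 0,
    fun x => ?_, fun y => ?_, fun x y => ?_⟩
  · by_cases h : x ∈ A <;> simp [h, hf x]
  · by_cases h : y ∈ B <;> simp [h, hg y]
  · by_cases h : x ∈ A <;> by_cases h' : y ∈ B <;> simp [h, h', hM]

open Classical in
theorem prod (A B : Set V) :
    HasL1Factorization 1 (fun x y => if x ∈ A ∧ y ∈ B then 1 else 0) :=
  mask ⟨PUnit, inferInstance, fun _ _ => 1, fun _ _ => 1, by simp, by simp, by simp⟩ A B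

/-- A block diagonal matrix factors as well as its blocks do. -/
theorem blockDiagonal {J : Type u} [Finite J] (p : V → J) (N : J → V → V → ℤ)
    (hN : ∀ j, HasL1Factorization C (N j)) (hM : ∀ x y, p x = p y → M x y = N (p x) x y)
    (hM₀ : ∀ x y, p x ≠ p y → M x y = 0) : HasL1Factorization C M := by
  classical
  have := Fintype.ofFinite J
  choose ι hι f g hf hg h using hN
  refine ⟨Σ j, ι j, inferInstance, fun x i => if p x = i.1 then f i.1 x i.2 else 0,
    fun x i => if p x = i.1 then g i.1 x i.2 else 0, fun x => ?_, fun x => ?_, fun x y => ?_⟩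
  · rw [Fintype.sum_sigma, Fintype.sum_eq_single (p x) (by intro j hj; simp [hj.symm])]
    simpa using hf _ x
  · rw [Fintype.sum_sigma, Fintype.sum_eq_single (p x) (by intro j hj; simp [hj.symm])]
    simpa using hg _ x
  · rw [Fintype.sum_sigma, Fintype.sum_eq_single (p x) (by intro j hj; simp [hj.symm])]
    by_cases hxy : p x = p y
    · rw [hM x y hxy, h]
      simp [hxy]
    · simp [hM₀ x y hxy, Ne.symm hxy]

open Classical in
theorem diagonal [Finite V] (A : Set V) :
    HasL1Factorization 1 (fun x y => if x ∈ A ∧ x = y then 1 else 0) :=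
  blockDiagonal id (fun _ x y => if x ∈ A ∧ y ∈ A then 1 else 0) (fun _ => prod A A)
    (fun x y h => by simp [show x = y from h]) (fun x y h => by simp [show x ≠ y from h])

theorem exists_coloring [Finite V] (h : HasL1Factorization C M) :
    ∃ c : V → Bool, ∀ y, |∑ᶠ x, (if c x then 1 else -1) * M x y| ≤ (2 * C * C : ℤ) := by
  classical
  have := Fintype.ofFinite V
  obtain ⟨ι, _, f, g, hf, hg, hM⟩ := h
  obtain ⟨ε, h1, -, h2⟩ := beckFiala (fun x i => (f x i : ℝ)) (Nat.cast_nonneg C)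
    (fun x => by exact_mod_cast hf x) 0 (by simp)
  refine ⟨fun x => decide (ε x = 1), fun y => ?_⟩
  have h3 : ∀ x, ((if decide (ε x = 1) then 1 else -1 : ℤ) : ℝ) = ε x := by
    intro x
    rcases eq_or_eq_neg_of_abs_eq (h1 x) with h | h <;> simp [h]
    norm_num
  have h4 : ∀ i, |∑ x, (if decide (ε x = 1) then 1 else -1) * f x i| ≤ 2 * (C : ℤ) := by
    intro i
    have := h2 i
    simp only [Pi.zero_apply, sub_zero] at this
    rw [← Finset.sum_congr rfl fun x _ => congrArg (· * (f x i : ℝ)) (h3 x)] at this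
    exact_mod_cast this
  rw [finsum_eq_sum_of_fintype]
  simp only [hM, Finset.mul_sum]
  rw [Finset.sum_comm]
  calc _ ≤ ∑ i, |g y i| * (2 * C) := by
        refine (Finset.abs_sum_le_sum_abs _ _).trans (Finset.sum_le_sum fun i _ => ?_)
        rw [show ∑ x, (if decide (ε x = 1) then 1 else -1) * (f x i * g y i)
          = g y i * ∑ x, (if decide (ε x = 1) then 1 else -1) * f x i by
            rw [Finset.mul_sum]; exact Finset.sum_congr rfl fun x _ => by ring, abs_mul]
        exact mul_le_mul_of_nonneg_left (h4 i) (abs_nonneg _)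
    _ = (∑ i, |g y i|) * (2 * C) := by rw [Finset.sum_mul]
    _ ≤ C * (2 * C) := by gcongr; exact hg y
    _ = _ := by ring

end HasL1Factorization

namespace SimpleGraph

variable {V : Type u} {G : SimpleGraph V}

/-! ### Blocks of the adjacency matrix -/

open Classical in
/-- The adjacency matrix of `G` with all rows outside `A` and columns outside `B` set to zero. -/
noncomputable def blockAdj (G : SimpleGraph V) (A B : Set V) (x y : V) : ℤ :=
  if x ∈ A ∧ y ∈ B ∧ G.Adj x y then 1 else 0

/-- The block of the adjacency matrix on `A × B` has an `ℓ¹` factorization with bound `C`. -/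
def BlockFactors (G : SimpleGraph V) (C : ℕ) (A B : Set V) : Prop :=
  HasL1Factorization C (G.blockAdj A B)

namespace BlockFactors

variable {C D : ℕ} {A A' A₁ A₂ B B' B₁ B₂ : Set V}

theorem mono_bound (h : G.BlockFactors C A B) (hCD : C ≤ D) : G.BlockFactors D A B :=
  HasL1Factorization.mono h hCD

theorem of_iff {H : SimpleGraph V} (h : G.BlockFactors C A B)
    (hGH : ∀ x ∈ A', ∀ y ∈ B', (H.Adj x y ↔ x ∈ A ∧ y ∈ B ∧ G.Adj x y)) :
    H.BlockFactors C A' B' := by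
  refine (HasL1Factorization.mask h A' B').congr fun x y => ?_
  have h3 := hGH x
  unfold blockAdj
  grind

theorem mono (h : G.BlockFactors C A B) (hA : A' ⊆ A) (hB : B' ⊆ B) :
    G.BlockFactors C A' B' :=
  h.of_iff fun _ hx _ hy => by simp [hA hx, hB hy]

theorem symm (h : G.BlockFactors C A B) : G.BlockFactors C B A := by
  refine (HasL1Factorization.transpose h).congr fun x y => ?_
  have := G.adj_comm x y
  unfold blockAdj
  grind

theorem of_not_adj (h : ∀ x ∈ A, ∀ y ∈ B, ¬ G.Adj x y) : G.BlockFactors C A B :=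
  HasL1Factorization.zero.congr fun x y => if_neg fun h' => h x h'.1 y h'.2.1 h'.2.2

theorem singleton_left (v : V) (B : Set V) : G.BlockFactors 1 {v} B := by
  refine (HasL1Factorization.prod {v} (B ∩ G.neighborSet v)).congr fun x y => ?_
  unfold blockAdj
  grind [mem_neighborSet]

theorem union_left (h₁ : G.BlockFactors C A₁ B) (h₂ : G.BlockFactors D A₂ B)
    (hA : A ⊆ A₁ ∪ A₂) : G.BlockFactors (C + D) A B := by
  -- The overlap of `A₁` and `A₂` is given to `A₁`, so that no row is counted twice.
  have h₁' := h₁.mono (Set.inter_subset_right (s := A)) subset_rfl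
  have h₂' : G.BlockFactors D (A \ A₁) B := h₂.mono (by grind) subset_rfl
  refine (HasL1Factorization.add h₁' h₂').congr fun x y => ?_
  unfold blockAdj
  grind

theorem union_right (h₁ : G.BlockFactors C A B₁) (h₂ : G.BlockFactors D A B₂)
    (hB : B ⊆ B₁ ∪ B₂) : G.BlockFactors (C + D) A B :=
  (h₁.symm.union_left h₂.symm hB).symm

theorem biUnion_left {ι : Type*} {X : ι → Set V} (F : Finset ι)
    (h : ∀ i ∈ F, G.BlockFactors C (X i) B) (hA : A ⊆ ⋃ i ∈ F, X i) :
    G.BlockFactors (F.card * C) A B := by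
  classical
  induction F using Finset.induction_on generalizing A with
  | empty => exact of_not_adj fun x hx => by simpa using hA hx
  | insert i F hi ih =>
    rw [Finset.card_insert_of_notMem hi, add_mul, one_mul, add_comm]
    refine (h i (by simp)).union_left (A₂ := ⋃ i ∈ F, X i)
      (ih (fun j hj => h j (by simp [hj])) subset_rfl) ?_
    simpa using hA

/-- The complementary block is the all-ones block minus the diagonal of `A ∩ B` minus the block of
`G`; the first two cost `1` each. -/
theorem compl [Finite V] (h : G.BlockFactors C A B) : Gᶜ.BlockFactors (C + 2) A B := by
  refine (((HasL1Factorization.prod A B).sub (HasL1Factorization.diagonal (A ∩ B))).sub h).mono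
    (by omega) |>.congr fun x y => ?_
  have : Gᶜ.Adj x y ↔ x ≠ y ∧ ¬ G.Adj x y := G.compl_adj x y
  have h0 : x = y → ¬ G.Adj x y := fun h h' => h'.ne h
  unfold blockAdj
  grind

theorem of_compl [Finite V] (h : Gᶜ.BlockFactors C A B) : G.BlockFactors (C + 2) A B := by
  simpa using h.compl

end BlockFactors

/-! ### Split trees and ladders -/

/-- There is a full binary tree of depth `d` whose inner nodes are labelled by vertices of `Y` and
whose leaves are labelled by vertices of `X`, in which a leaf is adjacent to an inner node above it
iff it lies in the first subtree of that node. -/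
def HasSplitTree (G : SimpleGraph V) : ℕ → Set V → Set V → Prop
  | 0, X, _ => X.Nonempty
  | d + 1, X, Y => ∃ b ∈ Y, G.HasSplitTree d (X ∩ G.neighborSet b) Y ∧
      G.HasSplitTree d (X \ G.neighborSet b) Y

namespace HasSplitTree

theorem mono {d : ℕ} {X X' Y Y' : Set V} (h : G.HasSplitTree d X Y) (hX : X ⊆ X') (hY : Y ⊆ Y') :
    G.HasSplitTree d X' Y' := by
  induction d generalizing X X' with
  | zero => exact Set.Nonempty.mono hX h
  | succ d ih =>
    obtain ⟨b, hb, h1, h2⟩ := h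
    exact ⟨b, hY hb, ih h1 (by gcongr), ih h2 (by gcongr)⟩

theorem nonempty {d : ℕ} {X Y : Set V} (h : G.HasSplitTree d X Y) : X.Nonempty := by
  induction d generalizing X with
  | zero => exact h
  | succ d ih =>
    obtain ⟨b, hb, h1, h2⟩ := h
    exact (ih h1).mono Set.inter_subset_left

/-- Ramsey property of binary trees with two-coloured inner nodes: if the root has the first colour,
either both subtrees contain a tree of depth `m - 1` in that colour, or one contains a tree of depth
`n` in the other. -/
theorem split_right {m n : ℕ} {X Y Y₁ Y₂ : Set V} (h : G.HasSplitTree (m + n) X Y)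
    (hY : Y ⊆ Y₁ ∪ Y₂) : G.HasSplitTree m X Y₁ ∨ G.HasSplitTree n X Y₂ := by
  induction hN : m + n generalizing m n X with
  | zero =>
    obtain rfl : m = 0 := by omega
    exact Or.inl h.nonempty
  | succ N ih =>
    rcases m.eq_zero_or_pos with rfl | hm
    · exact Or.inl h.nonempty
    rcases n.eq_zero_or_pos with rfl | hn
    · exact Or.inr h.nonempty
    rw [hN] at h
    obtain ⟨b, hb, h1, h2⟩ := h
    rcases hY hb with hb | hb
    · obtain ⟨m, rfl⟩ : ∃ m', m = m' + 1 := ⟨m - 1, by omega⟩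
      obtain rfl : m + n = N := by omega
      rcases ih h1 rfl with h1 | h1
      · rcases ih h2 rfl with h2 | h2
        · exact Or.inl ⟨b, hb, h1, h2⟩
        · exact Or.inr (h2.mono Set.sdiff_subset subset_rfl)
      · exact Or.inr (h1.mono Set.inter_subset_left subset_rfl)
    · obtain ⟨n, rfl⟩ : ∃ n', n = n' + 1 := ⟨n - 1, by omega⟩
      obtain rfl : m + n = N := by omega
      rcases ih h1 rfl with h1 | h1
      · exact Or.inl (h1.mono Set.inter_subset_left subset_rfl)
      · rcases ih h2 rfl with h2 | h2
        · exact Or.inl (h2.mono Set.sdiff_subset subset_rfl)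
        · exact Or.inr ⟨b, hb, h1, h2⟩

/-- Two sibling leaves are separated by their parent, so at least one differs from `v`; pruning the
last level keeps that one. -/
theorem diff_singleton_left {d : ℕ} {X Y : Set V} (h : G.HasSplitTree (d + 1) X Y) (v : V) :
    G.HasSplitTree d (X \ {v}) Y := by
  induction d generalizing X with
  | zero =>
    obtain ⟨b, hb, ⟨x, hx, hxb⟩, ⟨y, hy, hyb⟩⟩ := h
    by_cases hxv : x = v
    · exact ⟨y, hy, fun hyv => hyb (by rw [hyv, ← hxv]; exact hxb)⟩
    · exact ⟨x, hx, hxv⟩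
  | succ d ih =>
    obtain ⟨b, hb, h1, h2⟩ := h
    exact ⟨b, hb, (ih h1).mono (by grind) subset_rfl, (ih h2).mono (by grind) subset_rfl⟩

/-- No tree of depth `2` has all its labels equal to `v`: some leaf would be both adjacent and
non-adjacent to `v`. -/
theorem diff_singleton_right {d : ℕ} {X Y : Set V} (h : G.HasSplitTree (d + 2) X Y) (v : V) :
    G.HasSplitTree d X (Y \ {v}) := by
  rw [add_comm] at h
  refine (h.split_right (Y₁ := {v}) (Y₂ := Y \ {v}) (by simp)).resolve_left ?_
  rintro ⟨b, rfl, ⟨c, rfl, h1, x, hx⟩, h2⟩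
  exact hx.2 hx.1.2

end HasSplitTree

/-- Vertices `a 0, …, a (k - 1)` of `A` and `b 0, …, b (k - 1)` of `B`, all `a i` distinct from all
`b j`, such that `a i` and `b j` are adjacent iff `r i j`. -/
def HasPattern (G : SimpleGraph V) (r : ℕ → ℕ → Prop) (k : ℕ) (A B : Set V) : Prop :=
  ∃ a b : ℕ → V, ∀ i < k, ∀ j < k, a i ∈ A ∧ b j ∈ B ∧ a i ≠ b j ∧ (G.Adj (a i) (b j) ↔ r i j)

theorem HasPattern.mono {r : ℕ → ℕ → Prop} {k : ℕ} {A B A' B' : Set V}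
    (h : G.HasPattern r k A B) (hA : A ⊆ A') (hB : B ⊆ B') : G.HasPattern r k A' B' := by
  obtain ⟨a, b, h⟩ := h
  refine ⟨a, b, fun i hi j hj => ?_⟩
  obtain ⟨h1, h2, h3⟩ := h i hi j hj
  exact ⟨hA h1, hB h2, h3⟩

theorem HasPattern.cons {r : ℕ → ℕ → Prop} {k : ℕ} {A B A' B' : Set V} {a₀ b₀ : V}
    (h : G.HasPattern r k A' B') (hr : ∀ i j, r (i + 1) (j + 1) ↔ r i j)
    (ha₀ : a₀ ∈ A) (hb₀ : b₀ ∈ B) (hA : A' ⊆ A) (hB : B' ⊆ B)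
    (h₀ : a₀ ≠ b₀ ∧ (G.Adj a₀ b₀ ↔ r 0 0))
    (ha : ∀ b ∈ B', a₀ ≠ b ∧ ∀ j, (G.Adj a₀ b ↔ r 0 (j + 1)))
    (hb : ∀ a ∈ A', a ≠ b₀ ∧ ∀ i, (G.Adj a b₀ ↔ r (i + 1) 0)) :
    G.HasPattern r (k + 1) A B := by
  obtain ⟨a, b, h⟩ := h
  refine ⟨fun i => Nat.casesOn i a₀ a, fun j => Nat.casesOn j b₀ b, ?_⟩
  rintro (_ | i) hi (_ | j) hj
  · exact ⟨ha₀, hb₀, h₀⟩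
  · have h1 := (h j (by omega) j (by omega)).2.1
    exact ⟨ha₀, hB h1, (ha _ h1).1, (ha _ h1).2 j⟩
  · have h1 := (h i (by omega) i (by omega)).1
    exact ⟨hA h1, hb₀, (hb _ h1).1, (hb _ h1).2 i⟩
  · obtain ⟨h1, h2, h3, h4⟩ := h i (by omega) j (by omega)
    exact ⟨hA h1, hB h2, h3, h4.trans (hr i j).symm⟩

/-- A depth of split trees that forces a ladder of one of the two kinds. -/
def ladderDepth : ℕ → ℕ → ℕ
  | 0, _ => 0
  | _ + 1, 0 => 0
  | p + 1, q + 1 => (ladderDepth p (q + 1) + 2) + (ladderDepth (p + 1) q + 3)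

theorem HasSplitTree.exists_hasPattern {p q : ℕ} {X Y : Set V}
    (h : G.HasSplitTree (ladderDepth p q) X Y) :
    G.HasPattern (· ≤ ·) p X Y ∨ G.HasPattern (fun i j => j < i) q X Y := by
  induction hN : p + q generalizing p q X Y with
  | zero =>
    obtain ⟨a, -⟩ := h.nonempty
    obtain rfl : p = 0 := by omega
    exact Or.inl ⟨fun _ => a, fun _ => a, by simp⟩
  | succ N ih =>
    obtain ⟨a, ha⟩ := h.nonempty
    rcases p with _ | p
    · exact Or.inl ⟨fun _ => a, fun _ => a, by simp⟩
    rcases q with _ | q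
    · exact Or.inr ⟨fun _ => a, fun _ => a, by simp⟩
    rw [ladderDepth] at h
    -- The leaf `a` and the root `b` of the tree found become the first rung. The extra `2` pays for
    -- passing to a subtree and deleting `b` from the leaves, the extra `3` for deleting `a` from
    -- the labels and passing to a subtree.
    rcases h.split_right (Y₁ := Y ∩ G.neighborSet a) (Y₂ := Y \ G.neighborSet a) (by simp)
      with h | h
    · obtain ⟨b, ⟨hb, hab⟩, -, h⟩ := h
      rw [mem_neighborSet] at hab
      rcases ih (h.diff_singleton_left b) (by omega) with h | h
      · refine Or.inl (h.cons (a₀ := a) (b₀ := b) (by simp) ha hb (by grind) (by grind)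
          ⟨hab.ne, by simpa using hab⟩ (fun c hc => ?_) fun c hc => ?_)
        · have hc : G.Adj a c := hc.2
          exact ⟨hc.ne, fun j => by simpa using hc⟩
        · have hc' : ¬ G.Adj b c := hc.1.2
          exact ⟨hc.2, fun i => by simpa [G.adj_comm] using hc'⟩
      · exact Or.inr (h.mono (by grind) (by grind))
    · obtain ⟨b, ⟨⟨hb, hab⟩, hba⟩, h, -⟩ :=
        HasSplitTree.diff_singleton_right (d := ladderDepth (p + 1) q + 1) h a
      rw [mem_neighborSet] at hab
      rcases ih h (by omega) with h | h
      · exact Or.inl (h.mono (by grind) (by grind))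
      · refine Or.inr (h.cons (a₀ := a) (b₀ := b) (by simp) ha hb (by grind) (by grind)
          ⟨Ne.symm hba, by simpa using hab⟩ (fun c hc => ?_) fun c hc => ?_)
        · have hc' : ¬ G.Adj a c := hc.1.2
          exact ⟨Ne.symm hc.2, fun j => by simpa using hc'⟩
        · have hc' : G.Adj b c := hc.2
          exact ⟨hc'.ne', fun i => by simpa using hc'.symm⟩

/-- Reversing both orders turns a strict ladder into a weak one; the shift by one between the sides
costs one rung. -/
theorem HasPattern.of_gt {k : ℕ} {A B : Set V} (h : G.HasPattern (fun i j => j < i) (k + 1) A B) :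
    G.HasPattern (· ≤ ·) k A B := by
  obtain ⟨a, b, h⟩ := h
  refine ⟨fun i => a (k - i), fun j => b (k - 1 - j), fun i hi j hj => ?_⟩
  obtain ⟨h1, h2, h3, h4⟩ := h (k - i) (by omega) (k - 1 - j) (by omega)
  exact ⟨h1, h2, h3, h4.trans (by omega)⟩

theorem not_hasSplitTree_of_not_hasPattern {k : ℕ} (h : ¬ G.HasPattern (· ≤ ·) k Set.univ Set.univ)
    (X Y : Set V) : ¬ G.HasSplitTree (ladderDepth k (k + 1)) X Y := fun hT =>
  h ((hT.exists_hasPattern.elim id HasPattern.of_gt).mono (Set.subset_univ _) (Set.subset_univ _))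

/-- Either there is a long ladder, or one side is covered by few neighbourhoods, or the other side
is covered by few non-neighbourhoods. -/
theorem hasPattern_or_cover (k : ℕ) {A B : Set V} (hAB : Disjoint A B) :
    G.HasPattern (· ≤ ·) k A B ∨
    (∃ F : Finset V, F.card ≤ k ∧ ↑F ⊆ B ∧ A ⊆ ⋃ b ∈ F, G.neighborSet b) ∨
    ∃ F : Finset V, F.card ≤ k ∧ ↑F ⊆ A ∧ B ⊆ ⋃ a ∈ F, (G.neighborSet a)ᶜ := by
  classical
  induction k generalizing A B with
  | zero =>
    rcases A.eq_empty_or_nonempty with rfl | ⟨a, ha⟩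
    · exact Or.inr (Or.inl ⟨∅, by simp⟩)
    · exact Or.inl ⟨fun _ => a, fun _ => a, by simp⟩
  | succ k ih =>
    rcases A.eq_empty_or_nonempty with rfl | ⟨a, ha⟩
    · exact Or.inr (Or.inl ⟨∅, by simp⟩)
    rcases (B ∩ G.neighborSet a).eq_empty_or_nonempty with h | ⟨b, hb, hab⟩
    · refine Or.inr (Or.inr ⟨{a}, by simp, by simpa, ?_⟩)
      rw [Finset.set_biUnion_singleton]
      exact fun x hx hx' => h.subset ⟨hx, hx'⟩
    rw [mem_neighborSet] at hab
    -- The vertices dropped from `A` are covered by the neighbourhood of `b`, those dropped from `B`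
    -- by the non-neighbourhood of `a`, so a cover of either remainder extends by one set.
    rcases ih (A := A \ G.neighborSet b) (B := B ∩ G.neighborSet a)
      (hAB.mono Set.sdiff_subset Set.inter_subset_left) with h | ⟨F, hF, hFB, h⟩ | ⟨F, hF, hFA, h⟩
    · refine Or.inl (h.cons (a₀ := a) (b₀ := b) (by simp) ha hb (by grind) (by grind)
          ⟨hab.ne, by simpa using hab⟩ (fun c hc => ?_) fun c hc => ?_)
      · have hc : G.Adj a c := hc.2
        exact ⟨hc.ne, fun j => by simpa using hc⟩
      · have hc' : ¬ G.Adj b c := hc.2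
        exact ⟨(hAB.ne_of_mem hc.1 hb), fun i => by simpa [G.adj_comm] using hc'⟩
    · refine Or.inr (Or.inl ⟨insert b F, (Finset.card_insert_le _ _).trans (by omega), ?_, ?_⟩)
      · rw [Finset.coe_insert, Set.insert_subset_iff]
        exact ⟨hb, hFB.trans Set.inter_subset_left⟩
      · rw [Finset.set_biUnion_insert]
        intro x hx
        by_cases hxb : x ∈ G.neighborSet b
        · exact Or.inl hxb
        · exact Or.inr (h ⟨hx, hxb⟩)
    · refine Or.inr (Or.inr ⟨insert a F, (Finset.card_insert_le _ _).trans (by omega), ?_, ?_⟩)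
      · rw [Finset.coe_insert, Set.insert_subset_iff]
        exact ⟨ha, hFA.trans Set.sdiff_subset⟩
      · rw [Finset.set_biUnion_insert]
        intro x hx
        by_cases hxa : x ∈ G.neighborSet a
        · exact Or.inr (h ⟨hx, hxa⟩)
        · exact Or.inl hxa

theorem BlockFactors.of_not_hasPattern {k C : ℕ} {A B : Set V} (hAB : Disjoint A B)
    (hk : ¬ G.HasPattern (· ≤ ·) k A B) (hA : ∀ b ∈ B, G.BlockFactors C (A ∩ G.neighborSet b) B)
    (hB : ∀ a ∈ A, G.BlockFactors C (B \ G.neighborSet a) A) : G.BlockFactors (k * C) A B := by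
  rcases (G.hasPattern_or_cover k hAB).resolve_left hk with ⟨F, hF, hFB, h⟩ | ⟨F, hF, hFA, h⟩
  · refine (BlockFactors.biUnion_left F (fun b hb => hA b (hFB hb)) fun x hx => ?_).mono_bound
      (Nat.mul_le_mul_right C hF)
    have := h hx
    simp only [Set.mem_iUnion] at this ⊢
    exact this.imp fun b ⟨hb, hxb⟩ => ⟨hb, hx, hxb⟩
  · refine ((BlockFactors.biUnion_left F (fun a ha => hB a (hFA ha)) fun x hx => ?_).mono_bound
      (Nat.mul_le_mul_right C hF)).symm
    have := h hx
    simp only [Set.mem_iUnion] at this ⊢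
    exact this.imp fun b ⟨hb, hxb⟩ => ⟨hb, hx, hxb⟩

end SimpleGraph

namespace SimpleGraph

variable {V : Type u} {G : SimpleGraph V}

/-! ### Graphs without long induced paths -/

/-- `D` is not the union of two disjoint nonempty parts without edges between them. -/
def CutConnected (G : SimpleGraph V) (D : Set V) : Prop :=
  ∀ D' ⊆ D, D'.Nonempty → (∀ x ∈ D', ∀ y ∈ D, G.Adj x y → y ∈ D') → D' = D

/-- It suffices to factor the blocks of the connected components. -/
theorem BlockFactors.of_components [Finite V] {C : ℕ} (X : Set V)
    (h : ∀ D ⊆ X, D.Nonempty → G.CutConnected D → (∀ x ∈ D, ∀ y ∈ X, G.Adj x y → y ∈ D) →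
      G.BlockFactors C D D) : G.BlockFactors C X X := by
  -- The quotient by `r` is the set of components of `X`; a vertex outside `X` forms a class whose
  -- block is empty.
  let r : V → V → Prop := fun x y => x ∈ X ∧ y ∈ X ∧ G.Adj x y
  let D : Quot r → Set V := fun j => {x | x ∈ X ∧ Quot.mk r x = j}
  refine HasL1Factorization.blockDiagonal (Quot.mk r) (fun j => G.blockAdj (D j) (D j))
    (fun j => ?_) (fun x y hxy => ?_) fun x y hxy => ?_
  · rcases (D j).eq_empty_or_nonempty with h0 | h0
    · exact BlockFactors.of_not_adj fun x hx => by simp [h0] at hx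
    have closed : ∀ x ∈ D j, ∀ y ∈ X, G.Adj x y → y ∈ D j := fun x hx y hy hxy =>
      ⟨hy, (Quot.sound ⟨hx.1, hy, hxy⟩ : Quot.mk r x = Quot.mk r y).symm.trans hx.2⟩
    refine h _ (fun x hx => hx.1) h0 (fun D' hD' ⟨y, hy⟩ hcl => hD'.antisymm fun x hx => ?_) closed
    have lift : ∀ u v, r u v → (u ∈ D') = (v ∈ D') := fun u v ⟨hu, hv, huv⟩ => propext
      ⟨fun hu' => hcl u hu' v (closed u (hD' hu') v hv huv) huv,
        fun hv' => hcl v hv' u (closed v (hD' hv') u hu huv.symm) huv.symm⟩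
    have h1 : Quot.lift (· ∈ D') lift (Quot.mk r y) := hy
    rw [(hD' hy).2, ← hx.2] at h1
    exact h1
  · have hD : ∀ z, z ∈ D (Quot.mk r x) ↔ z ∈ X ∧ Quot.mk r z = Quot.mk r x := fun _ => Iff.rfl
    have hx := hD x
    have hy := hD y
    unfold blockAdj
    grind
  · exact if_neg fun h => hxy (Quot.sound h)

/-- `G` contains an induced path on `n` vertices. -/
def HasInducedPath (G : SimpleGraph V) (n : ℕ) : Prop :=
  ∃ p : ℕ → V, ∀ i < n, ∀ j < n,
    (p i = p j → i = j) ∧ (G.Adj (p i) (p j) ↔ i + 1 = j ∨ j + 1 = i)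

/-- The main induction for graphs without induced paths: `q 0, …, q n` is an induced path whose
first vertex only has neighbours in the connected set `D`. -/
theorem BlockFactors.of_cutConnected [Finite V] {C t : ℕ}
    (hC : ∀ v, G.BlockFactors C (G.neighborSet v) Set.univ) (ht : ¬ G.HasInducedPath t) (m : ℕ) :
    ∀ (n : ℕ) (q : ℕ → V) (D : Set V), t ≤ m + n + 1 →
      (∀ i ≤ n, ∀ j ≤ n, (q i = q j → i = j) ∧ (G.Adj (q i) (q j) ↔ i + 1 = j ∨ j + 1 = i)) →
      G.CutConnected D → (∀ i ≤ n, q i ∉ D) → (∃ w ∈ D, G.Adj (q 0) w) →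
      (∀ i ≤ n, i ≠ 0 → ∀ w ∈ D, ¬ G.Adj (q i) w) → G.BlockFactors (m * (2 * C)) D D := by
  induction m with
  | zero =>
    intro n q D htn hq
    exact absurd ⟨q, fun i hi j hj => hq i (by omega) j (by omega)⟩ ht
  | succ m ih =>
    intro n q D htn hq hD hqD hw hq0
    set N := G.neighborSet (q 0) with hN
    have h2 : G.BlockFactors (m * (2 * C)) (D \ N) (D \ N) := by
      refine BlockFactors.of_components _ fun E hE hEne hEc hEcl => ?_
      -- Connectedness of `D` links each component `E` of `D \ N` to some `w` in `N`. Prepending `w`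
      -- lengthens the induced path, and `E` avoids the neighbours of `q 0`.
      obtain ⟨w, hwN, hwD, z, hz, hwz⟩ : ∃ w, w ∈ N ∧ w ∈ D ∧ ∃ z ∈ E, G.Adj w z := by
        by_contra! hcon
        have hED : E = D := hD E (hE.trans Set.sdiff_subset) hEne fun x hx y hy hxy =>
          hEcl x hx y ⟨hy, fun hyN => hcon y hyN hy x hx hxy.symm⟩ hxy
        obtain ⟨w, hw, hqw⟩ := hw
        exact (hE (hED ▸ hw)).2 hqw
      refine ih (n + 1) (fun i => Nat.casesOn i w q) E (by omega) ?_ hEc ?_ ⟨z, hz, hwz⟩ ?_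
      · rintro (_ | i) hi (_ | j) hj
        · simp
        · refine ⟨fun h => (hqD j (by omega) ((show w = q j from h) ▸ hwD)).elim, ?_⟩
          rcases j with _ | j
          · simpa using hwN.symm
          · simpa [G.adj_comm] using hq0 (j + 1) (by omega) (by omega) w hwD
        · refine ⟨fun h => (hqD i (by omega) ((show q i = w from h).symm ▸ hwD)).elim, ?_⟩
          rcases i with _ | i
          · simpa [hN] using hwN
          · simpa using hq0 (i + 1) (by omega) (by omega) w hwD
        · obtain ⟨h1, h3⟩ := hq i (by omega) j (by omega)
          exact ⟨fun h => by rw [h1 h], h3.trans (by omega)⟩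
      · rintro (_ | i) hi h
        · exact (hE h).2 hwN
        · exact hqD i (by omega) (hE h).1
      · rintro (_ | _ | i) hi h0 z hz
        · exact absurd rfl h0
        · exact (hE hz).2
        · exact hq0 (i + 1) (by omega) (by omega) z (hE hz).1
    have h3 : G.BlockFactors (C + m * (2 * C)) (D \ N) D :=
      ((hC (q 0)).symm.mono (Set.subset_univ _) subset_rfl).union_right h2 (by grind)
    exact (((hC (q 0)).mono subset_rfl (Set.subset_univ _)).union_left h3 (by grind)).mono_bound
      (by linarith)

/-- The path argument starts in each component from a single vertex `v`; the row and the column of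
`v` account for the `2`. -/
theorem BlockFactors.of_not_hasInducedPath [Finite V] {C t : ℕ}
    (hC : ∀ v, G.BlockFactors C (G.neighborSet v) Set.univ) (ht : ¬ G.HasInducedPath t) :
    G.BlockFactors (t * (2 * C) + 2) Set.univ Set.univ := by
  refine BlockFactors.of_components _ fun D _ ⟨v, hv⟩ hD _ => ?_
  have h2 : G.BlockFactors (t * (2 * C)) (D \ {v}) (D \ {v}) := by
    refine BlockFactors.of_components _ fun E hE hEne hEc hEcl => ?_
    refine BlockFactors.of_cutConnected hC ht t 0 (fun _ => v) E (by omega) (by simp) hEc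
      (fun _ _ h => (hE h).2 rfl) ?_ (by simp)
    by_contra! hcon
    have hED : E = D := hD E (hE.trans Set.sdiff_subset) hEne fun x hx y hy hxy =>
      hEcl x hx y ⟨hy, fun hyv => hcon x hx (by rw [← show y = v from hyv]; exact hxy.symm)⟩ hxy
    exact (hE (hED ▸ hv)).2 rfl
  have h3 : G.BlockFactors (1 + t * (2 * C)) (D \ {v}) D :=
    (BlockFactors.singleton_left v _).symm.union_right h2 (by grind)
  exact ((BlockFactors.singleton_left v D).union_left h3 (by grind)).mono_bound (by linarith)

/-- `G` contains the path on `n` vertices as a semi-induced subgraph. -/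
def HasSemiInducedPath (G : SimpleGraph V) (n : ℕ) : Prop :=
  ∃ p : ℕ → V, ∀ i < n, ∀ j < n,
    (p i = p j → i = j) ∧ (Even i → ¬ Even j → (G.Adj (p i) (p j) ↔ i + 1 = j ∨ j + 1 = i))

theorem HasInducedPath.exists_adj {n : ℕ} {p : ℕ → V}
    (hp : ∀ i < n, ∀ j < n, (p i = p j → i = j) ∧ (G.Adj (p i) (p j) ↔ i + 1 = j ∨ j + 1 = i))
    (hn : 2 ≤ n) {i : ℕ} (hi : i < n) : ∃ w, G.Adj (p i) w := by
  by_cases h : i + 1 < n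
  · exact ⟨_, (hp i hi (i + 1) h).2.2 (Or.inl rfl)⟩
  · exact ⟨_, (hp i hi (i - 1) (by omega)).2.2 (Or.inr (by omega))⟩

/-- An induced path of a bipartite graph alternates between the sides, so between even and odd
positions no edge of `G` has been deleted. -/
theorem HasInducedPath.hasSemiInducedPath_of_between {n : ℕ} {A B : Set V} (hAB : Disjoint A B)
    (h : (G.between A B).HasInducedPath n) : G.HasSemiInducedPath n := by
  obtain ⟨p, hp⟩ := h
  refine ⟨p, fun i hi j hj => ⟨(hp i hi j hj).1, fun hi' hj' => ?_⟩⟩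
  have hn : 2 ≤ n := by
    rcases j with _ | j
    · simp at hj'
    · omega
  have step : ∀ i, i + 1 < n → (p i ∈ A ↔ p (i + 1) ∈ B) ∧ (p i ∈ B ↔ p (i + 1) ∈ A) := by
    intro i hi
    have h1 := (hp i (by omega) (i + 1) hi).2.2 (Or.inl rfl)
    rw [between_adj] at h1
    have := Set.disjoint_left.1 hAB
    grind
  have sides : ∀ i < n, (p i ∈ A ↔ (Even i ↔ p 0 ∈ A)) ∧ (p i ∈ B ↔ (Even i ↔ p 0 ∈ B)) := by
    obtain ⟨w, hw⟩ := HasInducedPath.exists_adj hp hn (i := 0) (by omega)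
    rw [between_adj] at hw
    have h0 := Set.disjoint_left.1 hAB
    intro i
    induction i with
    | zero => simp
    | succ i ih =>
      intro hi
      have h1 := ih (by omega)
      have h2 := step i hi
      rw [Nat.even_add_one]
      grind
  rw [← (hp i hi j hj).2, between_adj]
  obtain ⟨w, hw⟩ := HasInducedPath.exists_adj hp hn (i := 0) (by omega)
  rw [between_adj] at hw
  have h1 := sides i hi
  have h2 := sides j hj
  have h0 := Set.disjoint_left.1 hAB
  grind

/-- The graph `G` with all edges that are not inside `S` deleted. -/
def restrictTo (G : SimpleGraph V) (S : Set V) : SimpleGraph V where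
  Adj u v := u ∈ S ∧ v ∈ S ∧ G.Adj u v
  symm := ⟨fun _ _ h => ⟨h.2.1, h.1, h.2.2.symm⟩⟩
  loopless := ⟨fun _ h => h.2.2.ne rfl⟩

theorem HasInducedPath.hasSemiInducedPath_of_restrictTo {n : ℕ} {S : Set V}
    (h : (G.restrictTo S).HasInducedPath n) : G.HasSemiInducedPath n := by
  obtain ⟨p, hp⟩ := h
  refine ⟨p, fun i hi j hj => ⟨(hp i hi j hj).1, fun hi' hj' => ?_⟩⟩
  have hn : 2 ≤ n := by
    rcases j with _ | j
    · simp at hj'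
    · omega
  obtain ⟨_, hi1, -⟩ := HasInducedPath.exists_adj hp hn hi
  obtain ⟨_, hj1, -⟩ := HasInducedPath.exists_adj hp hn hj
  rw [← (hp i hi j hj).2]
  exact ⟨fun h => ⟨hi1, hj1, h⟩, fun h => h.2.2⟩

namespace BlockFactors

variable [Finite V] {C t : ℕ}

theorem of_between {A B : Set V} (hAB : Disjoint A B) (ht : ¬ G.HasSemiInducedPath t)
    (hA : ∀ b ∈ B, G.BlockFactors C (A ∩ G.neighborSet b) B)
    (hB : ∀ a ∈ A, G.BlockFactors C (B ∩ G.neighborSet a) A) :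
    G.BlockFactors (t * (2 * C) + 2) A B := by
  have h0 := Set.disjoint_left.1 hAB
  have hH : ∀ v w, (G.between A B).Adj v w ↔ G.Adj v w ∧ (v ∈ A ∧ w ∈ B ∨ v ∈ B ∧ w ∈ A) :=
    fun v w => between_adj
  refine (of_not_hasInducedPath (G := G.between A B) (C := C) (fun v => ?_)
    fun h => ht (h.hasSemiInducedPath_of_between hAB)).of_iff fun x hx y hy => by simp [hH, hx, hy]
  by_cases hvA : v ∈ A
  · refine (hB v hvA).of_iff fun x hx y _ => ?_
    simp only [mem_neighborSet, Set.mem_inter_iff] at hx ⊢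
    grind
  by_cases hvB : v ∈ B
  · refine (hA v hvB).of_iff fun x hx y _ => ?_
    simp only [mem_neighborSet, Set.mem_inter_iff] at hx ⊢
    grind
  · exact of_not_adj fun x hx => absurd hx (by rw [mem_neighborSet, hH]; grind)

theorem of_restrictTo {S : Set V} (ht : ¬ G.HasSemiInducedPath t)
    (hS : ∀ v ∈ S, G.BlockFactors C (S ∩ G.neighborSet v) S) :
    G.BlockFactors (t * (2 * C) + 2) S S := by
  have hH : ∀ v w, (G.restrictTo S).Adj v w ↔ v ∈ S ∧ w ∈ S ∧ G.Adj v w := fun v w => Iff.rfl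
  refine (of_not_hasInducedPath (G := G.restrictTo S) (C := C) (fun v => ?_)
    fun h => ht h.hasSemiInducedPath_of_restrictTo).of_iff fun x hx y hy => by simp [hH, hx, hy]
  by_cases hv : v ∈ S
  · refine (hS v hv).of_iff fun x hx y _ => ?_
    simp only [mem_neighborSet, Set.mem_inter_iff] at hx ⊢
    grind
  · exact of_not_adj fun x hx => absurd hx (by rw [mem_neighborSet, hH]; grind)

end BlockFactors

/-! ### The recursion on the depth of split trees -/

/-- Excludes long semi-induced paths, their bipartite complements, and long ladders. -/
structure ExcludesPathsAndLadders (G : SimpleGraph V) (t k : ℕ) : Prop where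
  path : ¬ G.HasSemiInducedPath t
  compl_path : ¬ Gᶜ.HasSemiInducedPath t
  ladder : ¬ G.HasPattern (· ≤ ·) k Set.univ Set.univ

/-- Induction on the sum of the two ranks, with leaves in `A` and in `B` respectively. `A₀` and `B₀`
collect the vertices with neighbourhoods of smaller rank; the other vertices have non-neighbourhoods
of smaller rank. -/
theorem exists_blockFactors_of_disjoint (t k n : ℕ) :
    ∃ C, ∀ (V : Type u) [Finite V] (G : SimpleGraph V), G.ExcludesPathsAndLadders t k →
      ∀ (A B : Set V), Disjoint A B → ∀ r s, r + s ≤ n → ¬ G.HasSplitTree r A B →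
        ¬ G.HasSplitTree s B A → G.BlockFactors C A B := by
  induction n with
  | zero =>
    refine ⟨0, fun V _ G _ A B _ r s hrs hA _ => ?_⟩
    obtain rfl : r = 0 := by omega
    obtain rfl := Set.not_nonempty_iff_eq_empty.1 hA
    exact BlockFactors.of_not_adj (by simp)
  | succ n ih =>
    obtain ⟨C, hC⟩ := ih
    refine ⟨(t * (2 * C) + 2) + k * C + (k * C + ((t * (2 * (C + 2)) + 2) + 2)),
      fun V _ G hG A B hAB r s hrs hA hB => ?_⟩
    rcases r with _ | r
    · obtain rfl := Set.not_nonempty_iff_eq_empty.1 hA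
      exact BlockFactors.of_not_adj (by simp)
    rcases s with _ | s
    · obtain rfl := Set.not_nonempty_iff_eq_empty.1 hB
      exact BlockFactors.of_not_adj (by simp)
    have recA : ∀ X ⊆ A, ∀ Y ⊆ B, ¬ G.HasSplitTree r X B → G.BlockFactors C X Y :=
      fun X hX Y hY h => hC V G hG X Y (hAB.mono hX hY) r (s + 1) (by omega)
        (fun h' => h (h'.mono subset_rfl hY)) fun h' => hB (h'.mono hY hX)
    have recB : ∀ X ⊆ A, ∀ Y ⊆ B, ¬ G.HasSplitTree s Y A → G.BlockFactors C Y X :=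
      fun X hX Y hY h => hC V G hG Y X (hAB.mono hX hY).symm s (r + 1) (by omega)
        (fun h' => h (h'.mono subset_rfl hX)) fun h' => hA (h'.mono hX hY)
    set A₀ := {a ∈ A | ¬ G.HasSplitTree s (B ∩ G.neighborSet a) A} with hA₀
    set B₀ := {b ∈ B | ¬ G.HasSplitTree r (A ∩ G.neighborSet b) B} with hB₀
    have hA₀A : A₀ ⊆ A := fun a ha => ha.1
    have hB₀B : B₀ ⊆ B := fun b hb => hb.1
    have hA₁A : A \ A₀ ⊆ A := Set.sdiff_subset
    have hB₁B : B \ B₀ ⊆ B := Set.sdiff_subset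
    have hA₁ : ∀ a ∈ A \ A₀, ¬ G.HasSplitTree s (B \ G.neighborSet a) A := fun a ha h =>
      hB ⟨a, ha.1, by_contra fun h' => ha.2 ⟨ha.1, h'⟩, h⟩
    have hB₁ : ∀ b ∈ B \ B₀, ¬ G.HasSplitTree r (A \ G.neighborSet b) B := fun b hb h =>
      hA ⟨b, hb.1, by_contra fun h' => hb.2 ⟨hb.1, h'⟩, h⟩
    have small : ∀ {d : ℕ} {X X' Y : Set V}, ¬ G.HasSplitTree d X' Y → X ⊆ X' →
      ¬ G.HasSplitTree d X Y := fun h hX h' => h (h'.mono hX subset_rfl)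
    have h₀₀ : G.BlockFactors (t * (2 * C) + 2) A₀ B₀ :=
      BlockFactors.of_between (hAB.mono hA₀A hB₀B) hG.path
        (fun b hb => recA _ (by grind) _ hB₀B (small hb.2 (by gcongr)))
        (fun a ha => recB _ hA₀A _ (by grind) (small ha.2 (by gcongr)))
    have h₁₁ : G.BlockFactors (t * (2 * (C + 2)) + 2 + 2) (A \ A₀) (B \ B₀) := by
      refine BlockFactors.of_compl (BlockFactors.of_between (hAB.mono hA₁A hB₁B) hG.compl_path
        (fun b hb => (recA _ (by grind) _ hB₁B (small (hB₁ b hb) ?_)).compl)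
        (fun a ha => (recB _ hA₁A _ (by grind) (small (hA₁ a ha) ?_)).compl)) <;>
      · rintro x ⟨hx, hx'⟩
        exact ⟨hx.1, fun h => ((G.compl_adj _ _).1 hx').2 h⟩
    have h₁₀ : G.BlockFactors (k * C) (A \ A₀) B₀ :=
      BlockFactors.of_not_hasPattern (hAB.mono hA₁A hB₀B)
        (fun h => hG.ladder (h.mono (Set.subset_univ _) (Set.subset_univ _)))
        (fun b hb => recA _ (by grind) _ hB₀B (small hb.2 (by gcongr)))
        (fun a ha => recB _ hA₁A _ (by grind) (small (hA₁ a ha) (by gcongr)))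
    have h₀₁ : G.BlockFactors (k * C) (B \ B₀) A₀ :=
      BlockFactors.of_not_hasPattern (hAB.mono hA₀A hB₁B).symm
        (fun h => hG.ladder (h.mono (Set.subset_univ _) (Set.subset_univ _)))
        (fun a ha => recB _ hA₀A _ (by grind) (small ha.2 (by gcongr)))
        (fun b hb => recA _ (by grind) _ hB₁B (small (hB₁ b hb) (by gcongr)))
    exact (h₀₀.union_left h₁₀ (by grind)).union_right (h₀₁.symm.union_left h₁₁ (by grind))
      (by grind)

/-- The same dichotomy inside one set `S`. The mixed block and all off-diagonal pieces lie between
disjoint sets, so the bipartite case handles them at cost `D`. -/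
theorem exists_blockFactors_self (t k r : ℕ) :
    ∃ C, ∀ (V : Type u) [Finite V] (G : SimpleGraph V), G.ExcludesPathsAndLadders t k →
      ∀ S : Set V, ¬ G.HasSplitTree r S S → G.BlockFactors C S S := by
  obtain ⟨D, hD⟩ := exists_blockFactors_of_disjoint.{u} t k
    (ladderDepth k (k + 1) + ladderDepth k (k + 1))
  replace hD : ∀ (V : Type u) [Finite V] (G : SimpleGraph V), G.ExcludesPathsAndLadders t k →
      ∀ A B : Set V, Disjoint A B → G.BlockFactors D A B := fun V _ G hG A B hAB =>
    hD V G hG A B hAB _ _ le_rfl (not_hasSplitTree_of_not_hasPattern hG.ladder _ _)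
      (not_hasSplitTree_of_not_hasPattern hG.ladder _ _)
  induction r with
  | zero =>
    refine ⟨0, fun V _ G _ S hS => ?_⟩
    obtain rfl := Set.not_nonempty_iff_eq_empty.1 hS
    exact BlockFactors.of_not_adj (by simp)
  | succ r ih =>
    obtain ⟨C, hC⟩ := ih
    refine ⟨(t * (2 * (C + D)) + 2) + D + (D + ((t * (2 * (C + D + 2)) + 2) + 2)),
      fun V _ G hG S hS => ?_⟩
    set S₀ := {v ∈ S | ¬ G.HasSplitTree r (S ∩ G.neighborSet v) S} with hS₀
    have hS₁ : ∀ v ∈ S \ S₀, ¬ G.HasSplitTree r (S \ G.neighborSet v) S := fun v hv h =>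
      hS ⟨v, hv.1, by_contra fun h' => hv.2 ⟨hv.1, h'⟩, h⟩
    have rec_small : ∀ X ⊆ S, ∀ Y ⊆ S, ¬ G.HasSplitTree r X S → G.BlockFactors (C + D) X Y :=
      fun X hX Y hY h => (hC V G hG X fun h' => h (h'.mono subset_rfl hX)).union_right
        (hD V G hG X (Y \ X) Set.disjoint_sdiff_right) (by grind)
    have h₀₀ : G.BlockFactors (t * (2 * (C + D)) + 2) S₀ S₀ :=
      BlockFactors.of_restrictTo hG.path fun v hv => rec_small _ (by grind) _ (by grind)
        fun h => hv.2 (h.mono (by grind) subset_rfl)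
    have h₁₁ : G.BlockFactors (t * (2 * (C + D + 2)) + 2 + 2) (S \ S₀) (S \ S₀) := by
      refine BlockFactors.of_compl (BlockFactors.of_restrictTo hG.compl_path fun v hv =>
        (rec_small _ (by grind) _ (by grind) fun h => hS₁ v hv (h.mono ?_ subset_rfl)).compl)
      rintro x ⟨hx, hx'⟩
      exact ⟨hx.1, fun h => ((G.compl_adj _ _).1 hx').2 h⟩
    have h₁₀ := hD V G hG (S \ S₀) S₀ Set.disjoint_sdiff_left
    exact (h₀₀.union_left h₁₀ (by grind)).union_right (h₁₀.symm.union_left h₁₁ (by grind))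
      (by grind)

/-! ### Semi-induced subgraphs -/

theorem containsSemiInduced_of_injective {W : Type*} (H : BipartiteGraph W) (f : W → V)
    (hf : Function.Injective f)
    (h : ∀ x ∈ H.left, ∀ y ∈ H.right, (H.graph.Adj x y ↔ G.Adj (f x) (f y))) :
    G.ContainsSemiInduced H := by
  have hdis := Set.disjoint_left.1 H.isBipartiteWith.disjoint
  have hcov : ∀ w, w ∈ H.left ∨ w ∈ H.right := fun w => by
    have := H.cover.ge (Set.mem_univ w)
    exact this
  have hadj := H.isBipartiteWith.mem_of_adj
  have hl : ∀ w, f w ∈ f '' H.left ↔ w ∈ H.left := fun w => hf.mem_set_image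
  have hr : ∀ w, f w ∈ f '' H.right ↔ w ∈ H.right := fun w => hf.mem_set_image
  refine ⟨f '' H.left, f '' H.right, (Set.disjoint_image_iff hf).2 H.isBipartiteWith.disjoint,
    ⟨Equiv.ofBijective (fun w => ⟨f w, by
      rw [Set.mem_union, hl, hr]; exact hcov w⟩) ⟨fun x y hxy => hf (congrArg Subtype.val hxy),
      ?_⟩, ?_⟩, fun w => (hl w).symm, fun w => (hr w).symm⟩
  · rintro ⟨_, ⟨w, -, rfl⟩ | ⟨w, -, rfl⟩⟩ <;> exact ⟨w, rfl⟩
  · intro x y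
    change (G.between _ _).Adj (f x) (f y) ↔ _
    rw [between_adj, hl, hl, hr, hr]
    constructor
    · rintro ⟨h1, ⟨hx, hy⟩ | ⟨hx, hy⟩⟩
      · exact (h x hx y hy).2 h1
      · exact ((h y hy x hx).2 h1.symm).symm
    · intro h1
      rcases hadj h1 with ⟨hx, hy⟩ | ⟨hx, hy⟩
      · exact ⟨(h x hx y hy).1 h1, Or.inl ⟨hx, hy⟩⟩
      · exact ⟨((h y hy x hx).1 h1.symm).symm, Or.inr ⟨hx, hy⟩⟩

theorem HasSemiInducedPath.containsSemiInduced {t : ℕ} (h : G.HasSemiInducedPath t) :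
    G.ContainsSemiInduced (BipartiteGraph.path t) := by
  obtain ⟨p, hp⟩ := h
  refine containsSemiInduced_of_injective _ (fun i : Fin t => p i)
    (fun i j hij => Fin.ext ((hp i i.2 j j.2).1 hij)) fun i hi j hj => ?_
  exact pathGraph_adj.trans ((hp i i.2 j j.2).2 hi hj).symm

theorem HasSemiInducedPath.containsSemiInduced_bipartiteCompl {t : ℕ}
    (h : Gᶜ.HasSemiInducedPath t) :
    G.ContainsSemiInduced (BipartiteGraph.path t).bipartiteCompl := by
  obtain ⟨p, hp⟩ := h
  have inj : ∀ i j : Fin t, p i = p j → i = j := fun i j hij => Fin.ext ((hp i i.2 j j.2).1 hij)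
  refine containsSemiInduced_of_injective _ (fun i : Fin t => p i) inj fun i hi j hj => ?_
  have hij : i ≠ j := fun h => hj (h ▸ hi)
  have h1 := (hp i i.2 j j.2).2 hi hj
  rw [← pathGraph_adj, compl_adj] at h1
  change ((pathGraph t)ᶜ.between _ _).Adj i j ↔ _
  rw [between_adj, compl_adj, ← h1]
  have h2 := mt (inj i j) hij
  have h3 : i ∈ (BipartiteGraph.path t).left ∧ j ∈ (BipartiteGraph.path t).right := ⟨hi, hj⟩
  tauto

theorem HasPattern.containsSemiInduced {k : ℕ} {A B : Set V} (h : G.HasPattern (· ≤ ·) k A B) :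
    G.ContainsSemiInduced (BipartiteGraph.halfGraph k) := by
  obtain ⟨a, b, h⟩ := h
  have hab : ∀ i j : Fin k, a i ≠ b j ∧ (G.Adj (a i) (b j) ↔ i ≤ j) :=
    fun i j => (h i i.2 j j.2).2.2
  refine containsSemiInduced_of_injective _ (Sum.elim (fun i : Fin k => a i) fun j : Fin k => b j)
    (Function.Injective.sumElim (fun i j hij => ?_) (fun i j hij => ?_) fun i j => (hab i j).1) ?_
  -- A pattern need not be injective by definition, but `a i = a j` transfers the diagonal edges and
  -- forces `i ≤ j` and `j ≤ i`.
  · have h1 := (hab i j).2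
    have h2 := (hab j i).2
    simp only [hij, (hab j j).2] at h1
    simp only [← hij, (hab i i).2] at h2
    simp at h1 h2
    exact le_antisymm h1 h2
  · have h1 := (hab i j).2
    have h2 := (hab j i).2
    simp only [← hij, (hab i i).2] at h1
    simp only [hij, (hab j j).2] at h2
    simp at h1 h2
    exact le_antisymm h1 h2
  · rintro _ ⟨i, rfl⟩ _ ⟨j, rfl⟩
    simp [BipartiteGraph.halfGraph, (hab i j).2]

end SimpleGraph

/-! ### The discrepancy bound -/

theorem mainTheorem7 (t k : ℕ) :
    ∃ C : ℕ, ∀ (V : Type*) [Finite V] (G : SimpleGraph V),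
      ¬ G.ContainsSemiInduced (BipartiteGraph.path t) →
      ¬ G.ContainsSemiInduced (BipartiteGraph.path t).bipartiteCompl →
      ¬ G.ContainsSemiInduced (BipartiteGraph.halfGraph k) →
      ∃ c : V → Bool, ∀ u : V,
        |({v | G.Adj u v ∧ c v = true}.ncard : ℤ) - ({v | G.Adj u v ∧ c v = false}.ncard : ℤ)|
          ≤ (C : ℤ) := by
  obtain ⟨C, hC⟩ := SimpleGraph.exists_blockFactors_self t k (SimpleGraph.ladderDepth k (k + 1))
  refine ⟨2 * C * C, fun V _ G h1 h2 h3 => ?_⟩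
  have hladder : ¬ G.HasPattern (· ≤ ·) k Set.univ Set.univ := fun h => h3 h.containsSemiInduced
  obtain ⟨c, hc⟩ := (hC V G ⟨fun h => h1 h.containsSemiInduced,
    fun h => h2 h.containsSemiInduced_bipartiteCompl, hladder⟩ Set.univ
    (SimpleGraph.not_hasSplitTree_of_not_hasPattern hladder _ _)).exists_coloring
  refine ⟨c, fun u => ?_⟩
  classical
  have := Fintype.ofFinite V
  -- The difference of the two neighbour counts is the signed sum of the column of `u`.
  convert hc u using 2
  swap
  · push_cast; rfl
  rw [finsum_eq_sum_of_fintype, Set.ncard_eq_toFinset_card', Set.ncard_eq_toFinset_card',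
    Finset.card_eq_sum_ones, Finset.card_eq_sum_ones, Set.toFinset_ofPred, Set.toFinset_ofPred,
    Finset.sum_filter, Finset.sum_filter]
  push_cast
  rw [← Finset.sum_sub_distrib]
  refine Finset.sum_congr rfl fun v _ => ?_
  have := G.adj_comm u v
  by_cases huv : G.Adj u v <;> cases hv : c v <;> simp_all [SimpleGraph.blockAdj]
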